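/- Let the Rudin–Shapiro polynomials be defined by $P_0(z)=Q_0(z)=1$, $P_{k+1}(z)=P_k(z)+z^{2^k}Q_k(z)$ and $Q_{k+1}(z)=P_k(z)-z^{2^k}Q_k(z)$ for $k\ge 0$. Let $\omega$ be a random variable uniformly distributed on the unit circle $\{z\in\mathbb{C}: |z|=1\}$. Then for every integer $n\ge 0$, $$\mathbb{E}\,\Big|\frac{P_k(\omega)}{\sqrt{2^{k+1}}}\Big|^{2n}\to\frac{1}{n+1}\qquad (k\to\infty),$$ and for all real $0\le\alpha<\beta\le 1$, $$\mathbb{P}\Big(\Big|\frac{P_k(\omega)}{\sqrt{2^{k+1}}}\Big|^{2}\in[\alpha,\beta]\Big)\to\beta-\alpha\qquad (k\to\infty);$$ that is, $|P_k(\omega)|^2/2^{k+1}$ converges in distribution to the uniform distribution on $[0,1]$. -/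

import Mathlib

open MeasureTheory ProbabilityTheory Filter Topology

/-- The pair `(P_k, Q_k)` of Rudin-Shapiro polynomials. -/
noncomputable def rudinShapiro : ℕ → Polynomial ℂ × Polynomial ℂ
  | 0 => (1, 1)
  | k + 1 =>
    ((rudinShapiro k).1 + Polynomial.X ^ (2 ^ k) * (rudinShapiro k).2,
      (rudinShapiro k).1 - Polynomial.X ^ (2 ^ k) * (rudinShapiro k).2)

/-- The Rudin-Shapiro polynomial `P_k`. -/
noncomputable def rudinShapiroP (k : ℕ) : Polynomial ℂ := (rudinShapiro k).1

/-- The Rudin-Shapiro polynomial `Q_k`. -/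
noncomputable def rudinShapiroQ (k : ℕ) : Polynomial ℂ := (rudinShapiro k).2

theorem rudinShapiroP_zero : rudinShapiroP 0 = 1 := rfl

theorem rudinShapiroQ_zero : rudinShapiroQ 0 = 1 := rfl

theorem rudinShapiroP_succ (k : ℕ) :
    rudinShapiroP (k + 1) = rudinShapiroP k + Polynomial.X ^ (2 ^ k) * rudinShapiroQ k := rfl

theorem rudinShapiroQ_succ (k : ℕ) :
    rudinShapiroQ (k + 1) = rudinShapiroP k - Polynomial.X ^ (2 ^ k) * rudinShapiroQ k := rfl

/-- The uniform probability measure on the unit circle `{z : ℂ | ‖z‖ = 1}`, as a measure on `ℂ`: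
the law of `exp (2 π i θ)` for `θ` distributed by the Haar probability measure on `ℝ / ℤ`. -/
noncomputable def uniformUnitCircle : Measure ℂ :=
  (AddCircle.haarAddCircle (T := 1)).map fun θ => (AddCircle.toCircle θ : ℂ)

/-!
The proof follows a matrix coefficient of a walk on `U(2)`. Up to the factor `2 ^ ((k + 1) / 2)`,
the numbers `P_k(z)` and `Q_k(z)` form a row of a unitary matrix, and passing from `k` to `k + 1`
multiplies this matrix by `diag(1, z ^ 2 ^ k)` and by a Hadamard matrix. In the representation on
binary forms of degree `2 * n`, the orbit of `x ^ n * y ^ n` is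
`(P x + Q y) ^ n * (-conj Q x + conj P y) ^ n`, and its coefficient at `x ^ n * y ^ n` is the shifted
Legendre polynomial of degree `n` in `s = |P_k|² / 2 ^ (k + 1)` (`conj_pow_mul_eval_coeff_orbitForm`).
The Legendre polynomials of positive degree integrate to `0` over `[0, 1]` and, with the constants,
span all polynomials. So it is enough that for `n ≠ 0` the mean of this coefficient tends to `0`;
then all moments of `s` converge to those of the uniform law, and Weierstrass approximation together
with the portmanteau theorem gives convergence in distribution.

The Fourier coefficients of the orbit at the frequencies `j * 2 ^ k`, `0 ≤ j ≤ 2 * n`, satisfy a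
linear recursion that does not depend on `k`; `j = n` stands for frequency zero, since all
frequencies are shifted by `n * 2 ^ k` to make them nonnegative. One step shifts the weight-`a` row,
discards the odd frequencies (`decimate`), and applies the Hadamard substitution
`(x, y) ↦ (x + y, x - y)`, whose matrix is `krawtchouk`. The latter is an isometry for the invariant
inner product, so the step is a contraction, and by Gelfand's formula its powers tend to zero as soon
as it has no eigenvalue of modulus one (`IsEigenarray.eq_zero`).

Let an eigenvector for such an eigenvalue be given. Nothing may be lost in the decimation, so the
form at frequency `j` is even or odd in `x` according to the parity of `j`. If `d > n` is its highest
frequency, only the rows `a ≤ 2 * n - d` contribute to the form at frequency `d`, which is thus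
divisible by `(x - y) ^ d`; by parity it is divisible by `(x + y) ^ d` too, and it vanishes because
`2 * d > 2 * n`. The lowest frequency is treated in the same way, so only frequency zero remains.
There the form is a multiple of `(x ^ 2 - y ^ 2) ^ n` whose coefficient at `y ^ (2 * n)` vanishes (it
has the wrong parity, or is moved by the step to a nonzero frequency), hence it is zero.
-/

namespace RudinShapiro

open Polynomial

/-! ### The Hadamard substitution on binary forms -/

/-- The `b`-th coefficient of `(X + 1) ^ a * (X - 1) ^ (N - a)`: for `a, b ≤ N`, the
coefficient of `x ^ b * y ^ (N - b)` in the image of the binary form `x ^ a * y ^ (N - a)` under the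
substitution `(x, y) ↦ (x + y, x - y)`. -/
noncomputable def krawtchouk (N a b : ℕ) : ℤ := ((X + 1) ^ a * (X - 1) ^ (N - a) : ℤ[X]).coeff b

theorem coeff_eq_krawtchouk {R : Type*} [CommRing R] (N a b : ℕ) :
    ((X + 1) ^ a * (X - 1) ^ (N - a) : R[X]).coeff b = (krawtchouk N a b : R) := by
  have h : ((X + 1) ^ a * (X - 1) ^ (N - a) : R[X]) =
      ((X + 1) ^ a * (X - 1) ^ (N - a) : ℤ[X]).map (Int.castRingHom R) := by simp
  rw [h, coeff_map, krawtchouk, eq_intCast]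

/-- Substituting `(u, v)` into the homogenization of a product of powers of linear polynomials. -/
theorem sum_coeff_linear_pow_mul {R A : Type*} [CommRing R] [CommRing A] [Algebra R A]
    (a b c d : R) (m l : ℕ) (u v : A) :
    ∑ i ∈ Finset.range (m + l + 1),
        algebraMap R A (((C a * X + C b) ^ m * (C c * X + C d) ^ l).coeff i) *
          (u ^ i * v ^ (m + l - i)) =
      (algebraMap R A a * u + algebraMap R A b * v) ^ m *
        (algebraMap R A c * u + algebraMap R A d * v) ^ l := by
  have hlin (a b : R) : (C a * X + C b).natDegree ≤ 1 := natDegree_linear_le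
  have hpow (p : R[X]) (hp : p.natDegree ≤ 1) (m : ℕ) :
      homogenize (p ^ m) m = homogenize p 1 ^ m := by
    have := homogenize_finsetProd (s := Finset.range m) (p := fun _ => p) (n := fun _ => 1)
      (fun _ _ => hp)
    simpa using this
  have hl (a b : R) : MvPolynomial.aeval ![u, v] (homogenize (C a * X + C b) 1) =
      algebraMap R A a * u + algebraMap R A b * v := by
    rw [homogenize_add, homogenize_C_mul, homogenize_X one_ne_zero, homogenize_C]
    simp
  have key : MvPolynomial.aeval ![u, v]
      (homogenize ((C a * X + C b) ^ m * (C c * X + C d) ^ l) (m + l)) =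
      (algebraMap R A a * u + algebraMap R A b * v) ^ m *
        (algebraMap R A c * u + algebraMap R A d * v) ^ l := by
    rw [homogenize_mul _ _ (natDegree_pow_le.trans (by nlinarith [hlin a b]))
      (natDegree_pow_le.trans (by nlinarith [hlin c d])), hpow _ (hlin a b), hpow _ (hlin c d),
      map_mul, map_pow, map_pow, hl, hl]
  rw [← key, homogenize, map_sum, Finset.Nat.sum_antidiagonal_eq_sum_range_succ_mk]
  refine Finset.sum_congr rfl fun i _ => ?_
  rw [MvPolynomial.aeval_monomial, Finsupp.prod_fintype _ _ (by simp)]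
  simp [Fin.prod_univ_two]

/-- The Krawtchouk matrix squares to `2 ^ N`, since the substitution `(x, y) ↦ (x + y, x - y)`
squares to multiplication by `2`. -/
theorem sum_krawtchouk_mul {N a c : ℕ} (ha : a ≤ N) :
    ∑ b ∈ Finset.range (N + 1), krawtchouk N a b * krawtchouk N b c =
      if a = c then 2 ^ N else 0 := by
  obtain ⟨l, rfl⟩ := Nat.exists_eq_add_of_le ha
  have h := sum_coeff_linear_pow_mul (R := ℤ) (A := ℤ[X]) 1 1 1 (-1) a l (X + 1) (X - 1)
  have h2 := congrArg (fun p => coeff p c) h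
  have e : (algebraMap ℤ ℤ[X] 1 * (X + 1) + algebraMap ℤ ℤ[X] 1 * (X - 1)) ^ a *
      (algebraMap ℤ ℤ[X] 1 * (X + 1) + algebraMap ℤ ℤ[X] (-1) * (X - 1)) ^ l =
      C ((2 : ℤ) ^ (a + l)) * X ^ a := by
    simp only [map_one, map_neg, one_mul, neg_mul]
    rw [show (X + 1 + (X - 1) : ℤ[X]) = 2 * X by ring, show (X + 1 + -(X - 1) : ℤ[X]) = 2 by ring,
      map_pow, show (C 2 : ℤ[X]) = 2 from rfl]
    ring
  rw [e] at h2
  simp only [finsetSum_coeff, coeff_C_mul, coeff_X_pow] at h2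
  rw [show (if a = c then (2 : ℤ) ^ (a + l) else 0) = 2 ^ (a + l) * if c = a then 1 else 0 by
    simp [eq_comm], ← h2]
  refine Finset.sum_congr rfl fun b hb => ?_
  rw [← C_eq_algebraMap, coeff_C_mul, coeff_eq_krawtchouk, Int.cast_id]
  congr 1
  rw [krawtchouk]
  simp [sub_eq_add_neg]

/-- The symmetry of the Krawtchouk matrix: both sides are the coefficient of `x ^ a * y ^ b` in
`(x * y + x + y - 1) ^ N`. -/
theorem choose_mul_krawtchouk {N a b : ℕ} (ha : a ≤ N) (hb : b ≤ N) :
    (N.choose a : ℤ) * krawtchouk N a b = N.choose b * krawtchouk N b a := by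
  let G : ℤ[X][X] := (X * C X + C X + X - 1) ^ N
  have hG (a b : ℕ) (ha : a ≤ N) : (G.coeff a).coeff b = N.choose a * krawtchouk N a b := by
    have e : G = ∑ i ∈ Finset.range (N + 1),
        C (((X + 1) ^ i * (X - 1) ^ (N - i) : ℤ[X]) * (N.choose i : ℤ[X])) * X ^ i := by
      simp only [G]
      rw [show (X * C X + C X + X - 1 : ℤ[X][X]) = C (X + 1) * X + C (X - 1) by simp; ring,
        add_pow]
      refine Finset.sum_congr rfl fun i _ => ?_
      simp only [map_mul, map_pow, map_natCast, mul_pow]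
      ring
    rw [e, finsetSum_coeff]
    simp only [coeff_C_mul, coeff_X_pow]
    rw [Finset.sum_eq_single a]
    · rw [if_pos rfl, mul_one, coeff_mul_natCast, mul_comm]; rfl
    · intro i _ hi; simp [hi.symm]
    · intro h; simp at h; omega
  have hswap (p : ℤ[X][X]) (a b : ℕ) : ((Bivariate.swap p).coeff a).coeff b =
      (p.coeff b).coeff a := by
    induction p using Polynomial.induction_on' with
    | add p q hp hq => simp [hp, hq]
    | monomial n f =>
      induction f using Polynomial.induction_on' with
      | add p q hp hq => simp [hp, hq]
      | monomial m r =>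
        rw [Bivariate.swap_monomial_monomial]
        simp only [coeff_monomial]
        split_ifs <;> simp_all [coeff_monomial]
  have hsym : Bivariate.swap G = G := by
    simp only [G, map_pow, map_sub, map_add, map_mul, map_one, Bivariate.swap_X, Bivariate.swap_Y]
    ring
  rw [← hG a b ha, ← hG b a hb, ← hswap, hsym]

/-- The Krawtchouk matrix is `2 ^ (N / 2)` times an isometry for the invariant inner product on
binary forms of degree `N`, in which the monomials are orthogonal and `x ^ b * y ^ (N - b)` has
squared norm `1 / N.choose b`. -/
theorem sum_normSq_krawtchouk (N : ℕ) (g : ℕ → ℂ) :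
    ∑ b ∈ Finset.range (N + 1),
        Complex.normSq (∑ a ∈ Finset.range (N + 1), (krawtchouk N a b : ℂ) * g a) / N.choose b =
      2 ^ N * ∑ a ∈ Finset.range (N + 1), Complex.normSq (g a) / N.choose a := by
  have hne {b : ℕ} (hb : b ∈ Finset.range (N + 1)) : (N.choose b : ℂ) ≠ 0 := by
    simp at hb
    exact_mod_cast (Nat.choose_pos (by omega)).ne'
  have hsym {a b : ℕ} (ha : a ∈ Finset.range (N + 1)) (hb : b ∈ Finset.range (N + 1)) :
      (krawtchouk N a b : ℂ) / N.choose b = krawtchouk N b a / N.choose a := by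
    have h : (N.choose a : ℂ) * krawtchouk N a b = N.choose b * krawtchouk N b a := by
      simp at ha hb
      exact_mod_cast choose_mul_krawtchouk (N := N) (by omega) (by omega)
    rw [div_eq_div_iff (hne hb) (hne ha)]
    linear_combination h
  have horth {a c : ℕ} (ha : a ∈ Finset.range (N + 1)) :
      ∑ b ∈ Finset.range (N + 1), (krawtchouk N a b : ℂ) * krawtchouk N b c =
        if a = c then 2 ^ N else 0 := by
    simp at ha
    exact_mod_cast congrArg (Int.cast : ℤ → ℂ) (sum_krawtchouk_mul (c := c) (by omega))
  apply Complex.ofReal_injective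
  push_cast
  simp only [← Complex.mul_conj, map_sum, map_mul, map_intCast]
  calc _ = ∑ b ∈ Finset.range (N + 1), ∑ c ∈ Finset.range (N + 1), ∑ a ∈ Finset.range (N + 1),
        (krawtchouk N a b : ℂ) * krawtchouk N b c * (g a * (starRingEnd ℂ) (g c) / N.choose c) := by
        refine Finset.sum_congr rfl fun b hb => ?_
        rw [Finset.mul_sum, Finset.sum_div]
        refine Finset.sum_congr rfl fun c hc => ?_
        rw [Finset.sum_mul, Finset.sum_div]
        refine Finset.sum_congr rfl fun a ha => ?_
        linear_combination (krawtchouk N a b * g a * (starRingEnd ℂ) (g c)) * hsym hc hb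
    _ = ∑ c ∈ Finset.range (N + 1), ∑ a ∈ Finset.range (N + 1),
        (if a = c then 2 ^ N else 0) * (g a * (starRingEnd ℂ) (g c) / N.choose c) := by
        rw [Finset.sum_comm]
        refine Finset.sum_congr rfl fun c hc => ?_
        rw [Finset.sum_comm]
        refine Finset.sum_congr rfl fun a ha => ?_
        rw [← Finset.sum_mul, horth ha]
    _ = _ := by
        rw [Finset.mul_sum]
        refine Finset.sum_congr rfl fun c hc => ?_
        rw [Finset.sum_eq_single c]
        · simp
        · intro a _ h; simp [h]
        · intro h; exact absurd hc h

/-! ### Parity and decimation -/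

/-- A polynomial of degree at most `N` that is even or odd and vanishes at some `s ≠ 0` to an order
exceeding `N / 2` also vanishes at `-s` to that order, hence is zero. -/
theorem eq_zero_of_pow_dvd_of_comp_neg {p : ℂ[X]} {N e : ℕ} (hN : p.natDegree ≤ N) (he : N < 2 * e)
    {s : ℂ} (hs : s ≠ 0) (hdvd : (X - C s) ^ e ∣ p) {c : ℂ} (hpar : p.comp (-X) = C c * p)
    (hc : c ≠ 0) : p = 0 := by
  by_contra hp
  have h1 : (X + C s) ^ e ∣ p := by
    have h : ((X - C s) ^ e).comp (-X) ∣ p.comp (-X) := by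
      obtain ⟨q, rfl⟩ := hdvd
      rw [mul_comp]
      exact dvd_mul_right _ _
    rw [hpar, pow_comp, sub_comp, X_comp, C_comp,
      show (-X - C s : ℂ[X]) = -(X + C s) by ring, neg_pow] at h
    have h' : (X + C s) ^ e ∣ C c * p := (dvd_mul_left _ _).trans h
    exact ((isUnit_C.2 (isUnit_iff_ne_zero.2 hc)).dvd_mul_left).1 h'
  have hcop : IsCoprime ((X - C s) ^ e) ((X + C s) ^ e) := by
    refine IsCoprime.pow ?_
    have := isCoprime_X_sub_C_of_isUnit_sub (R := ℂ) (a := s) (b := -s)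
      (isUnit_iff_ne_zero.2 (by
        rw [sub_neg_eq_add, ← two_mul]; exact mul_ne_zero two_ne_zero hs))
    simpa using this
  have h2 := natDegree_le_of_dvd (hcop.mul_dvd hdvd h1) hp
  rw [natDegree_mul (pow_ne_zero _ (X_sub_C_ne_zero s)) (pow_ne_zero _ (X_add_C_ne_zero s)),
    natDegree_pow, natDegree_pow, natDegree_X_sub_C, natDegree_X_add_C] at h2
  omega

/-- The rearrangement `(a, j) ↦ (a, 2 * j + a - N)` of an array indexed by `a, j ≤ N`, with zeros
where the index falls outside the array. On Fourier coefficients, it is multiplication of the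
`a`-th component by `z ^ (N - a)` followed by the extraction of the even frequencies. -/
def decimate (N : ℕ) (F : ℕ → ℕ → ℂ) (a j : ℕ) : ℂ :=
  if N ≤ 2 * j + a ∧ 2 * j + a ≤ 2 * N then F a (2 * j + a - N) else 0

theorem sum_normSq_decimate_le {N a : ℕ} (hN : Even N) (ha : a ≤ N) (F : ℕ → ℕ → ℂ) :
    ∑ j ∈ Finset.range (N + 1), Complex.normSq (decimate N F a j) ≤
      ∑ i ∈ Finset.range (N + 1) with Even (i + a), Complex.normSq (F a i) := by
  obtain ⟨n, rfl⟩ := hN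
  apply le_of_eq
  calc _ = ∑ j ∈ Finset.range (n + n + 1) with n + n ≤ 2 * j + a ∧ 2 * j + a ≤ 2 * (n + n),
        Complex.normSq (F a (2 * j + a - (n + n))) := by
        rw [Finset.sum_filter]
        refine Finset.sum_congr rfl fun j _ => ?_
        rw [decimate]
        split_ifs <;> simp
    _ = _ := by
        refine Finset.sum_nbij' (fun j => 2 * j + a - (n + n)) (fun i => (i + (n + n) - a) / 2)
          ?_ ?_ ?_ ?_ ?_
        · intro j hj
          simp only [Finset.mem_filter, Finset.mem_range, Nat.even_iff] at hj ⊢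
          omega
        · intro i hi
          simp only [Finset.mem_filter, Finset.mem_range, Nat.even_iff] at hi ⊢
          omega
        · intro j hj
          simp only [Finset.mem_filter, Finset.mem_range] at hj
          omega
        · intro i hi
          simp only [Finset.mem_filter, Finset.mem_range, Nat.even_iff] at hi
          omega
        · intro j _; rfl

/-- The `j`-th column of the array `F`, as a binary form of degree `N` dehomogenised at `y = 1`. -/
noncomputable def columnPoly (N : ℕ) (F : ℕ → ℕ → ℂ) (j : ℕ) : ℂ[X] :=
  ∑ a ∈ Finset.range (N + 1), C (F a j) * X ^ a

theorem coeff_columnPoly {N : ℕ} (F : ℕ → ℕ → ℂ) {b : ℕ} (j : ℕ) (hb : b ≤ N) :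
    (columnPoly N F j).coeff b = F b j := by
  simp only [columnPoly, finsetSum_coeff, coeff_C_mul, coeff_X_pow]
  rw [Finset.sum_eq_single b]
  · simp
  · intro i _ hi; simp [hi.symm]
  · intro h; simp at h; omega

theorem natDegree_columnPoly_le (N : ℕ) (F : ℕ → ℕ → ℂ) (j : ℕ) :
    (columnPoly N F j).natDegree ≤ N := by
  refine natDegree_sum_le_of_forall_le _ _ fun a ha => ?_
  simp at ha
  exact (natDegree_C_mul_X_pow_le _ _).trans (by omega)

theorem columnPoly_comp_neg {N : ℕ} {F : ℕ → ℕ → ℂ} {j : ℕ}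
    (hF : ∀ a ≤ N, ¬ Even (j + a) → F a j = 0) :
    (columnPoly N F j).comp (-X) = C ((-1) ^ j) * columnPoly N F j := by
  rw [columnPoly, Polynomial.sum_comp, Finset.mul_sum]
  refine Finset.sum_congr rfl fun a ha => ?_
  simp at ha
  by_cases h : Even (j + a)
  · rw [mul_comp, C_comp, pow_comp, X_comp, neg_pow]
    have : ((-1) ^ a : ℂ[X]) = (-1) ^ j := by
      have h1 : ((-1) ^ (j + a) : ℂ[X]) = 1 := h.neg_one_pow
      have h2 : ((-1) ^ (j + j) : ℂ[X]) = 1 := (Even.add_self j).neg_one_pow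
      rw [pow_add] at h1 h2
      linear_combination ((-1) ^ j : ℂ[X]) * h1 - ((-1) ^ a : ℂ[X]) * h2
    rw [this, map_pow, map_neg, map_one]
    ring
  · simp [hF a (by omega) h]

/-! ### Eigenvectors of the transfer operator -/

section Eigenarray

variable {n : ℕ} {F : ℕ → ℕ → ℂ} {μ : ℂ}

/-- `F` is an eigenarray, with eigenvalue `μ`, of the transfer operator: decimation followed by the
substitution `(x, y) ↦ (x + y, x - y)`, normalised so as to preserve the invariant norm. -/
def IsEigenarray (n : ℕ) (F : ℕ → ℕ → ℂ) (μ : ℂ) : Prop :=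
  ∀ b ≤ 2 * n, ∀ j ≤ 2 * n, μ * F b j = (-1 / 2) ^ n *
    ∑ a ∈ Finset.range (2 * n + 1), (krawtchouk (2 * n) a b : ℂ) * decimate (2 * n) F a j

theorem IsEigenarray.normSq_mul (h : IsEigenarray n F μ) {j : ℕ} (hj : j ≤ 2 * n) :
    Complex.normSq μ * ∑ b ∈ Finset.range (2 * n + 1), Complex.normSq (F b j) / (2 * n).choose b =
      ∑ a ∈ Finset.range (2 * n + 1),
        Complex.normSq (decimate (2 * n) F a j) / (2 * n).choose a := by
  have h1 := sum_normSq_krawtchouk (2 * n) (fun a => decimate (2 * n) F a j)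
  have h2 : Complex.normSq ((-1 / 2) ^ n) * 2 ^ (2 * n) = 1 := by
    rw [map_pow, map_div₀, pow_mul, ← mul_pow]
    norm_num
  calc _ = ∑ b ∈ Finset.range (2 * n + 1), Complex.normSq ((-1 / 2) ^ n) *
        (Complex.normSq (∑ a ∈ Finset.range (2 * n + 1),
          (krawtchouk (2 * n) a b : ℂ) * decimate (2 * n) F a j) / (2 * n).choose b) := by
        rw [Finset.mul_sum]
        refine Finset.sum_congr rfl fun b hb => ?_
        simp at hb
        rw [← mul_div_assoc, ← mul_div_assoc, ← map_mul, ← map_mul, h b (by omega) j hj]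
    _ = _ := by
        rw [← Finset.mul_sum, h1, ← mul_assoc, h2, one_mul]

/-- Frequencies of the wrong parity are lost in the decimation, so an eigenarray whose eigenvalue
has modulus at least `1` has none. -/
theorem IsEigenarray.eq_zero_of_not_even (h : IsEigenarray n F μ) (hμ : 1 ≤ Complex.normSq μ)
    {a i : ℕ} (ha : a ≤ 2 * n) (hi : i ≤ 2 * n) (hai : ¬ Even (i + a)) : F a i = 0 := by
  set N := 2 * n with hN
  set R := Finset.range (N + 1) with hR
  have hw {b : ℕ} (hb : b ∈ R) : (0 : ℝ) < (N.choose b : ℝ) := by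
    simp [hR] at hb
    exact_mod_cast Nat.choose_pos (by omega)
  have hQ : ∑ b ∈ R, (∑ j ∈ R, Complex.normSq (F b j)) / N.choose b ≤
      ∑ b ∈ R, (∑ j ∈ R with Even (j + b), Complex.normSq (F b j)) / N.choose b := by
    calc _ = ∑ j ∈ R, ∑ b ∈ R, Complex.normSq (F b j) / N.choose b := by
          rw [Finset.sum_comm]
          simp only [Finset.sum_div]
      _ ≤ ∑ j ∈ R, Complex.normSq μ * ∑ b ∈ R, Complex.normSq (F b j) / N.choose b := by
          refine Finset.sum_le_sum fun j _ => le_mul_of_one_le_left ?_ hμ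
          exact Finset.sum_nonneg fun b _ => div_nonneg (Complex.normSq_nonneg _) (by positivity)
      _ = ∑ j ∈ R, ∑ b ∈ R, Complex.normSq (decimate N F b j) / N.choose b := by
          refine Finset.sum_congr rfl fun j hj => ?_
          simp [hR] at hj
          exact h.normSq_mul (by omega)
      _ = ∑ b ∈ R, (∑ j ∈ R, Complex.normSq (decimate N F b j)) / N.choose b := by
          rw [Finset.sum_comm]
          simp only [Finset.sum_div]
      _ ≤ _ := by
          refine Finset.sum_le_sum fun b hb => div_le_div_of_nonneg_right ?_ (hw hb).le
          simp [hR] at hb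
          exact sum_normSq_decimate_le ⟨n, by omega⟩ (by omega) F
  have hsplit (b : ℕ) : ∑ j ∈ R, Complex.normSq (F b j) =
      ∑ j ∈ R with Even (j + b), Complex.normSq (F b j) +
        ∑ j ∈ R with ¬ Even (j + b), Complex.normSq (F b j) :=
    (Finset.sum_filter_add_sum_filter_not _ _ _).symm
  simp only [hsplit, add_div, Finset.sum_add_distrib] at hQ
  have hnn (b : ℕ) : 0 ≤ ∑ j ∈ R with ¬ Even (j + b), Complex.normSq (F b j) :=
    Finset.sum_nonneg fun j _ => Complex.normSq_nonneg _
  have h0 : ∑ b ∈ R, (∑ j ∈ R with ¬ Even (j + b), Complex.normSq (F b j)) / N.choose b = 0 :=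
    le_antisymm (by linarith)
      (Finset.sum_nonneg fun b _ => div_nonneg (hnn b) (by positivity))
  have haR : a ∈ R := by simp [hR]; omega
  have h1 := (Finset.sum_eq_zero_iff_of_nonneg
    (fun b _ => div_nonneg (hnn b) (by positivity))).1 h0 a haR
  rw [div_eq_zero_iff, or_iff_left (hw haR).ne'] at h1
  have h2 := (Finset.sum_eq_zero_iff_of_nonneg (fun j _ => Complex.normSq_nonneg _)).1 h1 i
    (Finset.mem_filter.2 ⟨by simp [hR]; omega, hai⟩)
  exact Complex.normSq_eq_zero.1 h2

theorem IsEigenarray.C_mul_columnPoly (h : IsEigenarray n F μ) {j : ℕ} (hj : j ≤ 2 * n) :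
    C μ * columnPoly (2 * n) F j = C ((-1 / 2) ^ n) * ∑ a ∈ Finset.range (2 * n + 1),
      C (decimate (2 * n) F a j) * ((X + 1) ^ a * (X - 1) ^ (2 * n - a)) := by
  ext b
  rw [coeff_C_mul, coeff_C_mul, finsetSum_coeff]
  simp only [coeff_C_mul, coeff_eq_krawtchouk]
  by_cases hb : b ≤ 2 * n
  · rw [coeff_columnPoly F j hb, h b hb j hj]
    congr 1
    exact Finset.sum_congr rfl fun a _ => mul_comm _ _
  · rw [coeff_eq_zero_of_natDegree_lt
      (lt_of_le_of_lt (natDegree_columnPoly_le _ _ _) (not_le.1 hb)), Finset.sum_eq_zero]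
    · simp
    intro a ha
    simp at ha
    have hdeg : ((X + 1) ^ a * (X - 1) ^ (2 * n - a) : ℂ[X]).natDegree ≤ 2 * n := by
      compute_degree!
      omega
    rw [← coeff_eq_krawtchouk, coeff_eq_zero_of_natDegree_lt (by omega), mul_zero]

/-- If every nonzero term in the expression of the `j`-th column of an eigenarray is divisible by
the same large power of `X - 1` or of `X + 1`, the column vanishes. -/
theorem IsEigenarray.column_eq_zero (h : IsEigenarray n F μ) (hμ : 1 ≤ Complex.normSq μ)
    {j e : ℕ} (hj : j ≤ 2 * n) (he : n < e) {s : ℂ} (hs : s ≠ 0)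
    (hdvd : ∀ a ≤ 2 * n, decimate (2 * n) F a j ≠ 0 →
      (X - C s) ^ e ∣ ((X + 1) ^ a * (X - 1) ^ (2 * n - a) : ℂ[X])) :
    ∀ a ≤ 2 * n, F a j = 0 := by
  have hμ0 : μ ≠ 0 := by rintro rfl; norm_num at hμ
  have hd : (X - C s) ^ e ∣ C μ * columnPoly (2 * n) F j := by
    rw [h.C_mul_columnPoly hj]
    refine Dvd.dvd.mul_left (Finset.dvd_sum fun a ha => ?_) _
    simp at ha
    by_cases h0 : decimate (2 * n) F a j = 0
    · simp [h0]
    · exact (hdvd a (by omega) h0).mul_left _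
  have hd' := ((isUnit_C.2 (isUnit_iff_ne_zero.2 hμ0)).dvd_mul_left).1 hd
  have h0 := eq_zero_of_pow_dvd_of_comp_neg (natDegree_columnPoly_le _ _ _) (by omega) hs hd'
    (columnPoly_comp_neg fun a ha hodd => h.eq_zero_of_not_even hμ ha hj hodd)
    (pow_ne_zero _ (by norm_num))
  intro a ha
  rw [← coeff_columnPoly F j ha, h0, coeff_zero]

/-- No frequency above the middle one occurs: the highest one present would give a column divisible
by a power of `X - 1` that is too large. -/
theorem IsEigenarray.eq_zero_of_lt (h : IsEigenarray n F μ) (hμ : 1 ≤ Complex.normSq μ)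
    {a j : ℕ} (ha : a ≤ 2 * n) (hj : j ≤ 2 * n) (hnj : n < j) : F a j = 0 := by
  induction hk : 2 * n - j using Nat.strong_induction_on generalizing a j with
  | _ k ih =>
    refine h.column_eq_zero hμ hj hnj one_ne_zero (fun a' ha' hne => ?_) a ha
    have hle : a' ≤ 2 * n - j := by
      by_contra hlt
      apply hne
      rw [decimate]
      split_ifs with hc
      · exact ih (2 * n - (2 * j + a' - 2 * n)) (by omega) ha' (by omega) (by omega) rfl
      · rfl
    rw [map_one]
    exact (pow_dvd_pow _ (by omega)).mul_left _

/-- No frequency below the middle one occurs: the lowest one present would give a column divisible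
by a power of `X + 1` that is too large. -/
theorem IsEigenarray.eq_zero_of_gt (h : IsEigenarray n F μ) (hμ : 1 ≤ Complex.normSq μ)
    {a j : ℕ} (ha : a ≤ 2 * n) (hnj : j < n) : F a j = 0 := by
  induction j using Nat.strong_induction_on generalizing a with
  | _ j ih =>
    refine h.column_eq_zero (e := 2 * n - j) (s := -1) hμ (by omega) (by omega) (by simp)
      (fun a' ha' hne => ?_) a ha
    have hle : 2 * n - j ≤ a' := by
      by_contra hlt
      apply hne
      rw [decimate]
      split_ifs with hc
      · exact ih (2 * j + a' - 2 * n) (by omega) ha' (by omega)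
      · rfl
    rw [map_neg, map_one, sub_neg_eq_add]
    exact (pow_dvd_pow _ hle).mul_right _

/-- The transfer operator has no eigenvalue of modulus at least `1`. -/
theorem IsEigenarray.eq_zero (h : IsEigenarray n F μ) (hn : n ≠ 0) (hμ : 1 ≤ Complex.normSq μ)
    {a j : ℕ} (ha : a ≤ 2 * n) (hj : j ≤ 2 * n) : F a j = 0 := by
  have hμ0 : μ ≠ 0 := by rintro rfl; norm_num at hμ
  have hmid {a j : ℕ} (ha : a ≤ 2 * n) (hj : j ≤ 2 * n) (hne : j ≠ n) : F a j = 0 := by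
    rcases lt_or_gt_of_ne hne with hlt | hgt
    · exact h.eq_zero_of_gt hμ ha hlt
    · exact h.eq_zero_of_lt hμ ha hj hgt
  -- The entry `F 0 n` is either of the wrong parity or moved by decimation to the zero column
  -- `3 * n / 2`, on which the norm identity shows that the decimated array vanishes.
  have h0 : F 0 n = 0 := by
    by_cases hpar : Even n
    · obtain ⟨m, hm⟩ := hpar
      have hj : 3 * m ≤ 2 * n := by omega
      have hs := h.normSq_mul hj
      rw [Finset.sum_eq_zero (fun b hb => by
        simp at hb
        rw [hmid (by omega) hj (by omega)]; simp), mul_zero] at hs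
      have := (Finset.sum_eq_zero_iff_of_nonneg (fun b _ =>
        div_nonneg (Complex.normSq_nonneg _) (by positivity))).1 hs.symm 0 (by simp)
      simp only [Nat.choose_zero_right, Nat.cast_one, div_one, Complex.normSq_eq_zero] at this
      rw [decimate, if_pos (by omega)] at this
      rwa [show 2 * (3 * m) + 0 - 2 * n = n by omega] at this
    · exact h.eq_zero_of_not_even hμ (by omega) (by omega) (by simpa using hpar)
  -- The middle column is a multiple of `(X ^ 2 - 1) ^ n`, with constant coefficient proportional to
  -- `F n n`.
  have hcol (b : ℕ) (hb : b ≤ 2 * n) :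
      μ * F b n = (-1 / 2) ^ n * (krawtchouk (2 * n) n b * F n n) := by
    rw [h b hb n (by omega), Finset.sum_eq_single n]
    · rw [decimate, if_pos (by omega), show 2 * n + n - 2 * n = n by omega]
    · intro a ha hne
      simp at ha
      rw [decimate, if_pos (by omega), hmid (by omega) (by omega) (by omega), mul_zero]
    · intro hc; simp at hc; omega
  have hK : (krawtchouk (2 * n) n 0 : ℂ) ≠ 0 := by
    rw [← coeff_eq_krawtchouk, coeff_zero_eq_eval_zero]
    simp
  have hnn : F n n = 0 := by
    have := hcol 0 (by omega)
    rw [h0, mul_zero] at this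
    simpa [hK] using this.symm
  by_cases hjn : j = n
  · subst hjn
    have := hcol a ha
    rw [hnn] at this
    simpa [hμ0] using this
  · exact hmid ha hj hjn

end Eigenarray

/-! ### Powers of the transfer operator -/

section Gelfand

attribute [local instance] Matrix.linftyOpNormedRing Matrix.linftyOpNormedAlgebra

/-- By Gelfand's formula, the powers of a complex matrix without eigenvalues of modulus at least `1`
tend to zero. -/
theorem tendsto_pow_mulVec_zero {ι : Type*} [Fintype ι] [DecidableEq ι] [Nonempty ι]
    (M : Matrix ι ι ℂ)
    (hM : ∀ (μ : ℂ) (v : ι → ℂ), M.mulVec v = μ • v → 1 ≤ Complex.normSq μ → v = 0) (v : ι → ℂ) :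
    Tendsto (fun k : ℕ => (M ^ k).mulVec v) atTop (𝓝 0) := by
  have : CompleteSpace (Matrix ι ι ℂ) := FiniteDimensional.complete ℂ _
  have hspec : ∀ μ ∈ spectrum ℂ M, ‖μ‖₊ < 1 := by
    intro μ hμ
    rw [← Matrix.spectrum_toLin', ← Module.End.hasEigenvalue_iff_mem_spectrum] at hμ
    obtain ⟨w, hw⟩ := hμ.exists_hasEigenvector
    by_contra hge
    refine hw.2 (hM μ w (by simpa using hw.apply_eq_smul) ?_)
    have : (1 : ℝ) ≤ ‖μ‖ := by exact_mod_cast not_lt.1 hge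
    rw [Complex.normSq_eq_norm_sq]
    nlinarith
  have hrad : spectralRadius ℂ M < 1 := by
    simpa using spectrum.spectralRadius_lt_of_forall_lt M (r := 1) hspec
  obtain ⟨r, hr1, hr2⟩ := ENNReal.lt_iff_exists_nnreal_btwn.1 hrad
  have hev := (spectrum.pow_nnnorm_pow_one_div_tendsto_nhds_spectralRadius M).eventually_lt_const hr1
  have hpow : Tendsto (fun k : ℕ => M ^ k) atTop (𝓝 0) := by
    refine squeeze_zero_norm' (a := fun k : ℕ => (r : ℝ) ^ k) ?_
      (tendsto_pow_atTop_nhds_zero_of_lt_one r.2 (by exact_mod_cast hr2))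
    filter_upwards [hev, eventually_gt_atTop 0] with k hk hk0
    have h1 : (‖M ^ k‖₊ : ENNReal) < (r : ENNReal) ^ (k : ℝ) := by
      rw [one_div] at hk
      exact (ENNReal.rpow_inv_lt_iff (by exact_mod_cast hk0)).1 hk
    rw [ENNReal.rpow_natCast] at h1
    exact_mod_cast h1.le
  have hcont : Continuous fun A : Matrix ι ι ℂ => A.mulVec v := by fun_prop
  simpa [Function.comp_def] using (hcont.tendsto 0).comp hpow

end Gelfand

/-- The transfer operator on arrays indexed by `a, j ≤ 2 * n`, as a matrix: `decimate` followed by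
`krawtchouk`. The factor `2⁻¹ ^ n` makes the substitution isometric, and the sign comes from its
determinant being negative. -/
noncomputable def transferMatrix (n : ℕ) :
    Matrix (Fin (2 * n + 1) × Fin (2 * n + 1)) (Fin (2 * n + 1) × Fin (2 * n + 1)) ℂ :=
  Matrix.of fun p q => (-1 / 2) ^ n *
    ((krawtchouk (2 * n) q.1 p.1 : ℂ) * if (q.2 : ℕ) + 2 * n = 2 * p.2 + q.1 then 1 else 0)

theorem transferMatrix_mulVec (n : ℕ) (F : ℕ → ℕ → ℂ) (p : Fin (2 * n + 1) × Fin (2 * n + 1)) :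
    (transferMatrix n).mulVec (fun q => F q.1 q.2) p = (-1 / 2) ^ n *
      ∑ a ∈ Finset.range (2 * n + 1),
        (krawtchouk (2 * n) a p.1 : ℂ) * decimate (2 * n) F a p.2 := by
  rw [Matrix.mulVec, dotProduct, Fintype.sum_prod_type, Finset.sum_range, Finset.mul_sum]
  refine Finset.sum_congr rfl fun a _ => ?_
  simp only [transferMatrix, Matrix.of_apply, mul_assoc, ← Finset.mul_sum]
  congr 2
  rw [decimate]
  split_ifs with hc
  · rw [Finset.sum_eq_single ⟨2 * (p.2 : ℕ) + a - 2 * n, by omega⟩]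
    · rw [if_pos (by simp; omega), one_mul]
    · intro i _ hi
      rw [if_neg, zero_mul]
      intro h
      exact hi (Fin.ext (by simp; omega))
    · simp
  · refine Finset.sum_eq_zero fun i _ => ?_
    rw [if_neg (by omega), zero_mul]

theorem tendsto_transferMatrix_pow {n : ℕ} (hn : n ≠ 0)
    (v : Fin (2 * n + 1) × Fin (2 * n + 1) → ℂ) :
    Tendsto (fun k : ℕ => (transferMatrix n ^ k).mulVec v) atTop (𝓝 0) := by
  refine tendsto_pow_mulVec_zero _ (fun μ v hv hμ => ?_) v
  let F : ℕ → ℕ → ℂ := fun a j =>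
    if h : a < 2 * n + 1 ∧ j < 2 * n + 1 then v (⟨a, h.1⟩, ⟨j, h.2⟩) else 0
  have hvF : v = fun q => F q.1 q.2 := by
    ext q
    have hq : (q.1 : ℕ) < 2 * n + 1 ∧ (q.2 : ℕ) < 2 * n + 1 := ⟨q.1.2, q.2.2⟩
    simp only [F, dif_pos hq]
  have hF : IsEigenarray n F μ := by
    intro b hb j hj
    have h1 := congrFun hv (⟨b, by omega⟩, ⟨j, by omega⟩)
    rw [hvF, transferMatrix_mulVec] at h1
    simpa using h1.symm
  rw [hvF]
  ext q
  exact hF.eq_zero hn hμ (by omega) (by omega)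

/-! ### The recursion for the Fourier coefficients of the orbit -/

/-- The reversed polynomials `(z ^ (2 ^ k) * conj (P_k z), z ^ (2 ^ k) * conj (Q_k z))`, `|z| = 1`,
given by the recursion that they satisfy. -/
noncomputable def conjPair : ℕ → ℂ[X] × ℂ[X]
  | 0 => (X, X)
  | k + 1 => (X ^ (2 ^ k) * (conjPair k).1 + (conjPair k).2,
      X ^ (2 ^ k) * (conjPair k).1 - (conjPair k).2)

theorem eval_conjPair (k : ℕ) {z : ℂ} (hz : ‖z‖ = 1) :
    (conjPair k).1.eval z = z ^ (2 ^ k) * (starRingEnd ℂ) ((rudinShapiroP k).eval z) ∧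
      (conjPair k).2.eval z = z ^ (2 ^ k) * (starRingEnd ℂ) ((rudinShapiroQ k).eval z) := by
  induction k with
  | zero => simp [conjPair, rudinShapiroP_zero, rudinShapiroQ_zero]
  | succ k ih =>
    have hzz : z ^ (2 ^ k) * (starRingEnd ℂ) z ^ (2 ^ k) = 1 := by
      rw [← mul_pow, Complex.mul_conj, Complex.normSq_eq_norm_sq, hz]
      simp
    have h2 : z ^ (2 ^ (k + 1)) = z ^ (2 ^ k) * z ^ (2 ^ k) := by
      rw [pow_succ 2, mul_two, pow_add]
    simp only [conjPair, rudinShapiroP_succ, rudinShapiroQ_succ, eval_add, eval_sub, eval_mul,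
      eval_pow, eval_X, ih.1, ih.2, map_add, map_sub, map_mul, map_pow, h2]
    constructor
    · linear_combination
        (-z ^ (2 ^ k) * (starRingEnd ℂ) ((rudinShapiroQ k).eval z)) * hzz
    · linear_combination
        (z ^ (2 ^ k) * (starRingEnd ℂ) ((rudinShapiroQ k).eval z)) * hzz

/-- The binary form `(P x + Q y) ^ n * (-S x + R y) ^ n`, dehomogenised at `y = 1`, where `P`, `Q`
are the Rudin-Shapiro polynomials of index `k` and `(R, S) = conjPair k`. On the unit circle it is
the orbit of `x ^ n * y ^ n`, up to normalisation and a shift of all frequencies by `n * 2 ^ k`. -/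
noncomputable def orbitForm (n k : ℕ) : ℂ[X][X] :=
  (C (rudinShapiroP k) * X + C (rudinShapiroQ k)) ^ n *
    (C (-(conjPair k).2) * X + C (conjPair k).1) ^ n

/-- Passing from `k` to `k + 1` is the substitution `(x, y) ↦ (x + y, z ^ 2 ^ k * (x - y))`, up to the
sign that it produces in the second factor. -/
theorem coeff_orbitForm_succ (n k b : ℕ) :
    (orbitForm n (k + 1)).coeff b = (-1) ^ n * ∑ a ∈ Finset.range (2 * n + 1),
      C (krawtchouk (2 * n) a b : ℂ) * ((orbitForm n k).coeff a * X ^ (2 ^ k * (2 * n - a))) := by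
  have h := sum_coeff_linear_pow_mul (R := ℂ[X]) (A := ℂ[X][X]) (rudinShapiroP k) (rudinShapiroQ k)
    (-(conjPair k).2) (conjPair k).1 n n (X + 1) (C (X ^ (2 ^ k)) * (X - 1))
  have e : orbitForm n (k + 1) = C ((-1) ^ n) *
      ((algebraMap ℂ[X] ℂ[X][X] (rudinShapiroP k) * (X + 1) +
        algebraMap ℂ[X] ℂ[X][X] (rudinShapiroQ k) * (C (X ^ (2 ^ k)) * (X - 1))) ^ n *
      (algebraMap ℂ[X] ℂ[X][X] (-(conjPair k).2) * (X + 1) +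
        algebraMap ℂ[X] ℂ[X][X] (conjPair k).1 * (C (X ^ (2 ^ k)) * (X - 1))) ^ n) := by
    simp only [algebraMap_eq, orbitForm, conjPair, rudinShapiroP_succ, rudinShapiroQ_succ]
    rw [← mul_pow, ← mul_pow, map_pow, ← mul_pow]
    congr 1
    simp only [map_add, map_sub, map_mul, map_neg, map_one]
    ring
  rw [e, ← h, coeff_C_mul, ← two_mul, finsetSum_coeff]
  congr 1
  refine Finset.sum_congr rfl fun a _ => ?_
  rw [algebraMap_eq, ← orbitForm, coeff_C_mul, mul_pow, ← map_pow, mul_left_comm, coeff_C_mul,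
    coeff_eq_krawtchouk, pow_mul]
  simp
  ring

theorem natDegree_coeff_orbitForm_le (n k a : ℕ) :
    ((orbitForm n k).coeff a).natDegree ≤ 2 * n * 2 ^ k := by
  induction k generalizing a with
  | zero =>
    have e : orbitForm n 0 = C (X ^ n) * ((X + 1) ^ n * (1 - X) ^ n : ℂ[X]).map C := by
      simp only [orbitForm, conjPair, rudinShapiroP_zero, rudinShapiroQ_zero, Polynomial.map_mul,
        Polynomial.map_pow, Polynomial.map_add, Polynomial.map_sub, Polynomial.map_one, map_X,
        map_pow, ← mul_pow, map_neg, map_one]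
      congr 1
      ring
    rw [e, coeff_C_mul, coeff_map]
    refine (natDegree_mul_C_le _ _).trans ?_
    simp
    omega
  | succ k ih =>
    rw [coeff_orbitForm_succ]
    have e : ((-1) ^ n : ℂ[X]) = C ((-1) ^ n) := by simp
    rw [e]
    refine (natDegree_C_mul_le _ _).trans (natDegree_sum_le_of_forall_le _ _ fun i _ => ?_)
    refine (natDegree_C_mul_le _ _).trans (natDegree_mul_le.trans ?_)
    rw [natDegree_X_pow, pow_succ]
    have h1 := ih i
    have h2 : 2 ^ k * (2 * n - i) ≤ 2 ^ k * (2 * n) := Nat.mul_le_mul_left _ (Nat.sub_le _ _)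
    linarith

/-- The Fourier coefficient of `orbitForm n k` at the monomial `Y ^ a` and the frequency
`j * 2 ^ k`. -/
noncomputable def orbitCoeff (n k a j : ℕ) : ℂ := ((orbitForm n k).coeff a).coeff (j * 2 ^ k)

/-- The recursion for the Fourier coefficients. Indices `j` outside `[0, 2 * n]` play no role because
of the degree bound `natDegree_coeff_orbitForm_le`. -/
theorem orbitCoeff_succ (n k b j : ℕ) :
    orbitCoeff n (k + 1) b j = (-1) ^ n * ∑ a ∈ Finset.range (2 * n + 1),
      (krawtchouk (2 * n) a b : ℂ) * decimate (2 * n) (orbitCoeff n k) a j := by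
  rw [orbitCoeff, coeff_orbitForm_succ, show ((-1) ^ n : ℂ[X]) = C ((-1) ^ n) by simp, coeff_C_mul,
    finsetSum_coeff]
  congr 1
  refine Finset.sum_congr rfl fun a ha => ?_
  simp at ha
  rw [coeff_C_mul, coeff_mul_X_pow', decimate]
  congr 1
  have hiff : 2 ^ k * (2 * n - a) ≤ j * 2 ^ (k + 1) ↔ 2 * n - a ≤ 2 * j := by
    rw [show j * 2 ^ (k + 1) = 2 ^ k * (2 * j) by ring]
    exact Nat.mul_le_mul_left_iff (by positivity)
  by_cases h1 : 2 * n - a ≤ 2 * j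
  · rw [if_pos (hiff.2 h1)]
    have e : j * 2 ^ (k + 1) - 2 ^ k * (2 * n - a) = (2 * j + a - 2 * n) * 2 ^ k := by
      rw [show j * 2 ^ (k + 1) = 2 ^ k * (2 * j) by ring, ← Nat.mul_sub, mul_comm]
      congr 1
      omega
    rw [e]
    by_cases h2 : 2 * j + a ≤ 2 * (2 * n)
    · rw [if_pos ⟨by omega, h2⟩, orbitCoeff]
    · rw [if_neg (by tauto)]
      refine coeff_eq_zero_of_natDegree_lt
        (lt_of_le_of_lt (natDegree_coeff_orbitForm_le n k a) ?_)
      exact Nat.mul_lt_mul_of_pos_right (by omega) (by positivity)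
  · rw [if_neg (fun h => h1 (hiff.1 h)), if_neg (by omega)]

theorem transferMatrix_pow_mulVec_orbitCoeff (n k : ℕ) :
    (transferMatrix n ^ k).mulVec (fun q => orbitCoeff n 0 q.1 q.2) =
      fun q => ((1 / 2) ^ n) ^ k * orbitCoeff n k q.1 q.2 := by
  induction k with
  | zero => simp
  | succ k ih =>
    rw [pow_succ', ← Matrix.mulVec_mulVec, ih]
    ext p
    have h := transferMatrix_mulVec n (fun a j => ((1 / 2) ^ n) ^ k * orbitCoeff n k a j) p
    rw [h, orbitCoeff_succ]
    have hdec (a j : ℕ) : decimate (2 * n) (fun a j => ((1 / 2) ^ n) ^ k * orbitCoeff n k a j) a j =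
        ((1 / 2) ^ n) ^ k * decimate (2 * n) (orbitCoeff n k) a j := by
      simp only [decimate]
      split_ifs <;> simp
    simp only [hdec, mul_left_comm _ (((1 / 2 : ℂ) ^ n) ^ k), ← Finset.mul_sum]
    rw [pow_succ, show ((-1 / 2 : ℂ)) ^ n = (1 / 2) ^ n * (-1) ^ n by rw [← mul_pow]; norm_num]
    ring

theorem tendsto_orbitCoeff {n : ℕ} (hn : n ≠ 0) :
    Tendsto (fun k : ℕ => ((1 / 2 : ℂ) ^ n) ^ k * orbitCoeff n k n n) atTop (𝓝 0) := by
  have h := tendsto_transferMatrix_pow hn (fun q => orbitCoeff n 0 q.1 q.2)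
  simp only [transferMatrix_pow_mulVec_orbitCoeff] at h
  simpa using (tendsto_pi_nhds.1 h) (⟨n, by omega⟩, ⟨n, by omega⟩)

theorem coeff_linear_pow_mul_linear_pow {R : Type*} [CommRing R] (a b c d : R) (n : ℕ) :
    ((C a * X + C b) ^ n * (C c * X + C d) ^ n).coeff n =
      ∑ i ∈ Finset.range (n + 1), (n.choose i : R) ^ 2 * ((a * d) ^ i * (b * c) ^ (n - i)) := by
  have hco (a b : R) {m : ℕ} (hm : m ≤ n) :
      ((C a * X + C b) ^ n).coeff m = a ^ m * b ^ (n - m) * n.choose m := by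
    rw [add_pow, finsetSum_coeff, Finset.sum_eq_single m]
    · rw [mul_pow, ← map_pow, ← map_pow, coeff_mul_natCast, mul_right_comm, ← map_mul, coeff_C_mul,
        coeff_X_pow_self, mul_one]
    · intro i _ hi
      rw [mul_pow, ← map_pow, ← map_pow, coeff_mul_natCast, mul_right_comm, ← map_mul, coeff_C_mul,
        coeff_X_pow, if_neg hi.symm, mul_zero, zero_mul]
    · intro h; simp at h; omega
  rw [coeff_mul, Finset.Nat.sum_antidiagonal_eq_sum_range_succ_mk]
  refine Finset.sum_congr rfl fun i hi => ?_
  simp at hi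
  rw [hco a b (by omega), hco c d (by omega), Nat.choose_symm (by omega), mul_pow, mul_pow,
    Nat.sub_sub_self (by omega)]
  ring

/-! ### Shifted Legendre polynomials -/

/-- The Legendre polynomial of degree `n`, shifted to `[0, 1]`. The normalisation is `1` at `1`, so it
differs from `Polynomial.shiftedLegendre` by the sign `(-1) ^ n`. -/
noncomputable def legendre (n : ℕ) : ℝ[X] :=
  ∑ i ∈ Finset.range (n + 1), C ((n.choose i : ℝ) ^ 2) * (X ^ i * (X - 1) ^ (n - i))

/-- Rodrigues' formula. -/
theorem factorial_mul_legendre (n : ℕ) :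
    C (n.factorial : ℝ) * legendre n = derivative^[n] (X ^ n * (X - 1) ^ n) := by
  rw [iterate_derivative_mul, legendre, Finset.mul_sum]
  refine Finset.sum_congr rfl fun k hk => ?_
  simp at hk
  rw [show (X - 1 : ℝ[X]) = X - C 1 by simp, iterate_derivative_X_sub_pow,
    iterate_derivative_X_pow_eq_smul, Nat.sub_sub_self (by omega)]
  have h : (n.factorial : ℝ) * (n.choose k : ℝ) ^ 2 =
      n.choose k * (n.descFactorial (n - k) * n.descFactorial k) := by
    rw [Nat.descFactorial_eq_factorial_mul_choose, Nat.descFactorial_eq_factorial_mul_choose,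
      Nat.choose_symm (by omega), ← Nat.choose_mul_factorial_mul_factorial (show k ≤ n by omega)]
    push_cast
    ring
  rw [← mul_assoc, ← C_mul, h]
  simp only [nsmul_eq_mul, smul_eq_C_mul, map_mul, map_natCast]
  ring

theorem intervalIntegral_eval_derivative (p : ℝ[X]) (a b : ℝ) :
    ∫ x in a..b, (derivative p).eval x = p.eval b - p.eval a :=
  intervalIntegral.integral_eq_sub_of_hasDerivAt (fun x _ => p.hasDerivAt x)
    ((derivative p).continuous.intervalIntegrable _ _)

/-- The Legendre polynomials of positive degree are orthogonal to the constants. -/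
theorem integral_legendre {n : ℕ} (hn : n ≠ 0) : ∫ x in (0 : ℝ)..1, (legendre n).eval x = 0 := by
  obtain ⟨m, rfl⟩ := Nat.exists_eq_succ_of_ne_zero hn
  have h := factorial_mul_legendre (m + 1)
  set G : ℝ[X] := derivative^[m] (X ^ (m + 1) * (X - 1) ^ (m + 1)) with hG
  rw [Function.iterate_succ_apply', ← hG] at h
  have h0 : G.eval 0 = 0 := by
    have : (X : ℝ[X]) ^ (m + 1 - m) ∣ G :=
      pow_sub_dvd_iterate_derivative_of_pow_dvd m (dvd_mul_right _ _)
    rw [Nat.add_sub_cancel_left, pow_one, X_dvd_iff, coeff_zero_eq_eval_zero] at this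
    exact this
  have h1 : G.eval 1 = 0 := by
    have : (X - 1 : ℝ[X]) ^ (m + 1 - m) ∣ G :=
      pow_sub_dvd_iterate_derivative_of_pow_dvd m (dvd_mul_left _ _)
    rw [Nat.add_sub_cancel_left, pow_one, show (X - 1 : ℝ[X]) = X - C 1 by simp,
      dvd_iff_isRoot] at this
    exact this
  have h2 := intervalIntegral_eval_derivative G 0 1
  rw [← h, h0, h1] at h2
  simpa [Nat.factorial_ne_zero] using h2

theorem natDegree_legendre_le (n : ℕ) : (legendre n).natDegree ≤ n := by
  refine natDegree_sum_le_of_forall_le _ _ fun i hi => ?_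
  simp at hi
  compute_degree!
  omega

theorem coeff_legendre_self_pos (n : ℕ) : 0 < (legendre n).coeff n := by
  have h (i : ℕ) (hi : i ≤ n) : ((X ^ i * (X - 1) ^ (n - i) : ℝ[X])).coeff n = 1 := by
    have hm : (X ^ i * (X - C 1) ^ (n - i) : ℝ[X]).Monic :=
      (monic_X_pow i).mul ((monic_X_sub_C 1).pow _)
    have hd : (X ^ i * (X - C 1) ^ (n - i) : ℝ[X]).natDegree = n := by
      rw [(monic_X_pow i).natDegree_mul ((monic_X_sub_C 1).pow _), natDegree_X_pow, natDegree_pow,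
        natDegree_X_sub_C]
      omega
    have := hm.coeff_natDegree
    rwa [hd, map_one] at this
  rw [legendre, finsetSum_coeff]
  refine Finset.sum_pos (fun i hi => ?_) ⟨0, by simp⟩
  simp at hi
  rw [coeff_C_mul, h i (by omega), mul_one]
  have := Nat.choose_pos (show i ≤ n by omega)
  positivity

/-! ### The central matrix coefficient as a Legendre polynomial -/

theorem normSq_eval_add (k : ℕ) {z : ℂ} (hz : ‖z‖ = 1) :
    ‖(rudinShapiroP k).eval z‖ ^ 2 + ‖(rudinShapiroQ k).eval z‖ ^ 2 = 2 ^ (k + 1) := by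
  induction k with
  | zero => norm_num [rudinShapiroP_zero, rudinShapiroQ_zero]
  | succ k ih =>
    have h := parallelogram_law_with_norm ℝ ((rudinShapiroP k).eval z)
      (z ^ (2 ^ k) * (rudinShapiroQ k).eval z)
    simp only [rudinShapiroP_succ, rudinShapiroQ_succ, eval_add, eval_sub, eval_mul, eval_pow,
      eval_X]
    rw [norm_mul, norm_pow, hz, one_pow, one_mul] at h
    rw [pow_succ 2 (k + 1), ← ih]
    linarith

/-- The squared modulus `|P_k(z)|² / 2 ^ (k + 1)` of the normalised Rudin-Shapiro polynomial. -/
noncomputable def normalizedSq (k : ℕ) (z : ℂ) : ℝ :=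
  ‖(rudinShapiroP k).eval z / (Real.sqrt (2 ^ (k + 1)) : ℂ)‖ ^ 2

theorem normalizedSq_eq (k : ℕ) (z : ℂ) :
    normalizedSq k z = ‖(rudinShapiroP k).eval z‖ ^ 2 / 2 ^ (k + 1) := by
  rw [normalizedSq, norm_div, div_pow, Complex.norm_real, Real.norm_eq_abs, sq_abs,
    Real.sq_sqrt (by positivity)]

theorem normalizedSq_mem_Icc (k : ℕ) {z : ℂ} (hz : ‖z‖ = 1) :
    normalizedSq k z ∈ Set.Icc (0 : ℝ) 1 := by
  refine ⟨by unfold normalizedSq; positivity, ?_⟩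
  rw [normalizedSq_eq, div_le_one (by positivity), ← normSq_eval_add k hz]
  exact le_add_of_nonneg_right (by positivity)

theorem continuous_normalizedSq (k : ℕ) : Continuous (normalizedSq k) := by
  unfold normalizedSq
  exact ((rudinShapiroP k).continuous.div_const _).norm.pow 2

/-- The matrix coefficient of the orbit at the zero weight and zero frequency is a Legendre
polynomial in `|P_k|²`. -/
theorem conj_pow_mul_eval_coeff_orbitForm (n k : ℕ) {z : ℂ} (hz : ‖z‖ = 1) :
    (starRingEnd ℂ) z ^ (n * 2 ^ k) * ((orbitForm n k).coeff n).eval z =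
      2 ^ ((k + 1) * n) * (((legendre n).eval (normalizedSq k z) : ℝ) : ℂ) := by
  obtain ⟨hR, hS⟩ := eval_conjPair k hz
  have h1 : ((orbitForm n k).coeff n).eval z = ∑ i ∈ Finset.range (n + 1), (n.choose i : ℂ) ^ 2 *
      (((rudinShapiroP k).eval z * (conjPair k).1.eval z) ^ i *
        ((rudinShapiroQ k).eval z * -(conjPair k).2.eval z) ^ (n - i)) := by
    rw [orbitForm, coeff_linear_pow_mul_linear_pow, eval_finsetSum]
    simp
  have hP : (((rudinShapiroP k).eval z * (conjPair k).1.eval z)) =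
      z ^ (2 ^ k) * (2 ^ (k + 1) * normalizedSq k z) := by
    rw [hR, normalizedSq_eq, mul_left_comm, Complex.mul_conj, Complex.normSq_eq_norm_sq]
    push_cast
    field_simp
  have hQ : (((rudinShapiroQ k).eval z * -(conjPair k).2.eval z)) =
      z ^ (2 ^ k) * (2 ^ (k + 1) * (normalizedSq k z - 1)) := by
    have h2 : ((‖(rudinShapiroQ k).eval z‖ ^ 2 : ℝ) : ℂ) =
        ((2 ^ (k + 1) - ‖(rudinShapiroP k).eval z‖ ^ 2 : ℝ) : ℂ) := by
      rw [← normSq_eval_add k hz]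
      congr 1
      ring
    rw [hS, normalizedSq_eq, mul_neg, mul_left_comm, Complex.mul_conj, Complex.normSq_eq_norm_sq,
      h2]
    push_cast
    field_simp
    ring
  have hzz : (starRingEnd ℂ) z ^ (n * 2 ^ k) * (z ^ (2 ^ k)) ^ n = 1 := by
    rw [mul_comm n, pow_mul, ← mul_pow, ← mul_pow, mul_comm, Complex.mul_conj,
      Complex.normSq_eq_norm_sq, hz]
    simp
  rw [h1, legendre, eval_finsetSum, Complex.ofReal_sum, Finset.mul_sum, Finset.mul_sum]
  refine Finset.sum_congr rfl fun i hi => ?_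
  simp at hi
  rw [hP, hQ]
  obtain ⟨l, rfl⟩ := Nat.exists_eq_add_of_le (show i ≤ n by omega)
  simp only [eval_mul, eval_C, eval_pow, eval_sub, eval_X, eval_one, Complex.ofReal_mul,
    Complex.ofReal_pow, Complex.ofReal_natCast, Complex.ofReal_sub, Complex.ofReal_one,
    Nat.add_sub_cancel_left]
  rw [pow_add (z ^ (2 ^ k))] at hzz
  rw [pow_mul (2 : ℂ) (k + 1) (i + l), pow_add ((2 : ℂ) ^ (k + 1)) i l]
  simp only [mul_pow]
  linear_combination (((i + l).choose i : ℂ) ^ 2 * ((2 ^ (k + 1)) ^ i * (normalizedSq k z) ^ i *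
    ((2 ^ (k + 1)) ^ l * (normalizedSq k z - 1) ^ l))) * hzz

/-! ### From Legendre polynomials to equidistribution -/

section Equidistribution

variable {ν : ℕ → Measure ℝ} [∀ k, IsProbabilityMeasure (ν k)]

theorem integrable_of_continuous_of_ae_mem_Icc {m : Measure ℝ} [IsFiniteMeasure m]
    (hm : ∀ᵐ x ∂m, x ∈ Set.Icc (0 : ℝ) 1) {f : ℝ → ℝ} (hf : Continuous f) : Integrable f m := by
  obtain ⟨B, hB⟩ := (isCompact_Icc (a := (0 : ℝ)) (b := 1)).exists_bound_of_continuousOn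
    hf.continuousOn
  exact Integrable.of_bound hf.aestronglyMeasurable B (hm.mono hB)

/-- Since the Legendre polynomials span all polynomials, their integrals determine all moments. -/
theorem tendsto_moment (hν : ∀ k, ∀ᵐ x ∂ν k, x ∈ Set.Icc (0 : ℝ) 1)
    (hleg : ∀ n ≠ 0, Tendsto (fun k => ∫ x, (legendre n).eval x ∂ν k) atTop (𝓝 0)) (n : ℕ) :
    Tendsto (fun k => ∫ x, x ^ n ∂ν k) atTop (𝓝 (1 / ((n : ℝ) + 1))) := by
  induction n using Nat.strong_induction_on with
  | _ n ih =>
    rcases eq_or_ne n 0 with rfl | hn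
    · simp
    have hexp (x : ℝ) : (legendre n).eval x =
        ∑ i ∈ Finset.range n, (legendre n).coeff i * x ^ i + (legendre n).coeff n * x ^ n := by
      rw [← Finset.sum_range_succ]
      exact eval_eq_sum_range' (Nat.lt_succ_of_le (natDegree_legendre_le n)) x
    have hint (k i : ℕ) : Integrable (fun x : ℝ => x ^ i) (ν k) :=
      integrable_of_continuous_of_ae_mem_Icc (hν k) (by fun_prop)
    have hkey (k : ℕ) : ∫ x, (legendre n).eval x ∂ν k =
        ∑ i ∈ Finset.range n, (legendre n).coeff i * ∫ x, x ^ i ∂ν k +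
          (legendre n).coeff n * ∫ x, x ^ n ∂ν k := by
      simp only [hexp]
      rw [integral_add (integrable_finsetSum _ fun i _ => (hint k i).const_mul _)
        ((hint k n).const_mul _), integral_finsetSum _ fun i _ => (hint k i).const_mul _,
        integral_const_mul]
      simp only [integral_const_mul]
    have hlim : ∑ i ∈ Finset.range n, (legendre n).coeff i * (1 / ((i : ℝ) + 1)) +
        (legendre n).coeff n * (1 / ((n : ℝ) + 1)) = 0 := by
      rw [← integral_legendre hn]
      simp only [hexp]
      rw [intervalIntegral.integral_add (by apply Continuous.intervalIntegrable; fun_prop)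
        (by apply Continuous.intervalIntegrable; fun_prop),
        intervalIntegral.integral_finsetSum
          fun i _ => by apply Continuous.intervalIntegrable; fun_prop]
      simp
    have hc := coeff_legendre_self_pos n
    have hsum : Tendsto (fun k => ∑ i ∈ Finset.range n, (legendre n).coeff i * ∫ x, x ^ i ∂ν k)
        atTop (𝓝 (∑ i ∈ Finset.range n, (legendre n).coeff i * (1 / ((i : ℝ) + 1)))) :=
      tendsto_finsetSum _ fun i hi => (ih i (Finset.mem_range.1 hi)).const_mul _
    have h := ((hleg n hn).sub hsum).const_mul ((legendre n).coeff n)⁻¹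
    have e : ((legendre n).coeff n)⁻¹ *
        (0 - ∑ i ∈ Finset.range n, (legendre n).coeff i * (1 / ((i : ℝ) + 1))) =
        1 / ((n : ℝ) + 1) := by
      rw [← hlim]
      field_simp
      ring
    rw [e] at h
    refine h.congr fun k => ?_
    rw [hkey]
    field_simp
    ring

theorem tendsto_integral_eval
    (hν : ∀ k, ∀ᵐ x ∂ν k, x ∈ Set.Icc (0 : ℝ) 1)
    (hmom : ∀ n : ℕ, Tendsto (fun k => ∫ x, x ^ n ∂ν k) atTop (𝓝 (1 / ((n : ℝ) + 1)))) (p : ℝ[X]) :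
    Tendsto (fun k => ∫ x, p.eval x ∂ν k) atTop (𝓝 (∫ x in (0 : ℝ)..1, p.eval x)) := by
  induction p using Polynomial.induction_on' with
  | add p q hp hq =>
    simp only [eval_add]
    rw [intervalIntegral.integral_add (p.continuous.intervalIntegrable _ _)
      (q.continuous.intervalIntegrable _ _)]
    refine (hp.add hq).congr fun k => ?_
    rw [integral_add (integrable_of_continuous_of_ae_mem_Icc (hν k) p.continuous)
      (integrable_of_continuous_of_ae_mem_Icc (hν k) q.continuous)]
  | monomial n a =>
    simp only [eval_monomial, integral_const_mul, intervalIntegral.integral_const_mul]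
    have : ∫ x in (0 : ℝ)..1, x ^ n = 1 / ((n : ℝ) + 1) := by simp
    rw [this]
    exact (hmom n).const_mul a

theorem tendsto_integral_of_continuous
    (hν : ∀ k, ∀ᵐ x ∂ν k, x ∈ Set.Icc (0 : ℝ) 1)
    (hmom : ∀ n : ℕ, Tendsto (fun k => ∫ x, x ^ n ∂ν k) atTop (𝓝 (1 / ((n : ℝ) + 1))))
    {f : ℝ → ℝ} (hf : Continuous f) :
    Tendsto (fun k => ∫ x, f x ∂ν k) atTop (𝓝 (∫ x in (0 : ℝ)..1, f x)) := by
  rw [Metric.tendsto_atTop]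
  intro ε hε
  obtain ⟨p, hp⟩ := exists_polynomial_near_of_continuousOn 0 1 f hf.continuousOn (ε / 3)
    (by positivity)
  obtain ⟨K, hK⟩ := Metric.tendsto_atTop.1 (tendsto_integral_eval hν hmom p) (ε / 3) (by positivity)
  refine ⟨K, fun k hk => ?_⟩
  have h1 : |∫ x, p.eval x ∂ν k - ∫ x, f x ∂ν k| ≤ ε / 3 := by
    rw [← integral_sub (integrable_of_continuous_of_ae_mem_Icc (hν k) p.continuous)
      (integrable_of_continuous_of_ae_mem_Icc (hν k) hf)]
    have := norm_integral_le_of_norm_le_const (μ := ν k) (f := fun x => p.eval x - f x)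
      (C := ε / 3) ((hν k).mono fun x hx => (hp x hx).le)
    simpa using this
  have h2 : |(∫ x in (0 : ℝ)..1, p.eval x) - ∫ x in (0 : ℝ)..1, f x| ≤ ε / 3 := by
    rw [← intervalIntegral.integral_sub (p.continuous.intervalIntegrable _ _)
      (hf.intervalIntegrable _ _)]
    have := intervalIntegral.norm_integral_le_of_norm_le_const (a := 0) (b := 1)
      (f := fun x => p.eval x - f x) (C := ε / 3) (fun x hx => by
        rw [Set.uIoc_of_le zero_le_one] at hx
        exact (hp x ⟨hx.1.le, hx.2⟩).le)
    simpa using this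
  have h3 := hK k hk
  rw [Real.dist_eq] at h3 ⊢
  rw [abs_lt] at h3 ⊢
  rw [abs_le] at h1 h2
  constructor <;> linarith

/-- Probability measures on `[0, 1]` whose moments tend to those of the uniform distribution become
equidistributed. -/
theorem tendsto_measureReal_Icc
    (hν : ∀ k, ∀ᵐ x ∂ν k, x ∈ Set.Icc (0 : ℝ) 1)
    (hmom : ∀ n : ℕ, Tendsto (fun k => ∫ x, x ^ n ∂ν k) atTop (𝓝 (1 / ((n : ℝ) + 1))))
    {α β : ℝ} (hα : 0 ≤ α) (hαβ : α ≤ β) (hβ : β ≤ 1) :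
    Tendsto (fun k => (ν k).real (Set.Icc α β)) atTop (𝓝 (β - α)) := by
  have hprob : IsProbabilityMeasure (volume.restrict (Set.Ioc (0 : ℝ) 1)) := ⟨by simp⟩
  let P : ℕ → ProbabilityMeasure ℝ := fun k => ⟨ν k, inferInstance⟩
  let U : ProbabilityMeasure ℝ := ⟨volume.restrict (Set.Ioc (0 : ℝ) 1), hprob⟩
  have hPU : Tendsto P atTop (𝓝 U) := by
    rw [ProbabilityMeasure.tendsto_iff_forall_integral_tendsto]
    intro f
    have := tendsto_integral_of_continuous hν hmom f.continuous
    rwa [intervalIntegral.integral_of_le zero_le_one] at this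
  have hnull : (U : Measure ℝ) (frontier (Set.Icc α β)) = 0 := by
    change volume.restrict (Set.Ioc (0 : ℝ) 1) _ = 0
    rw [frontier_Icc hαβ]
    exact ((Set.toFinite {α, β}).measure_zero _)
  have h := ProbabilityMeasure.tendsto_measure_of_null_frontier_of_tendsto' hPU hnull
  have h2 := (ENNReal.tendsto_toReal (measure_ne_top (U : Measure ℝ) _)).comp h
  have hU : ((U : Measure ℝ) (Set.Icc α β)).toReal = β - α := by
    change (volume.restrict (Set.Ioc (0 : ℝ) 1) (Set.Icc α β)).toReal = _
    rw [Measure.restrict_congr_set Ioc_ae_eq_Icc, Measure.restrict_apply measurableSet_Icc,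
      Set.inter_eq_left.2 (Set.Icc_subset_Icc hα hβ), Real.volume_Icc,
      ENNReal.toReal_ofReal (by linarith)]
  rw [hU] at h2
  exact h2

end Equidistribution

/-! ### Integration over the unit circle -/

theorem measurable_toCircle :
    Measurable fun θ : AddCircle (1 : ℝ) => (AddCircle.toCircle θ : ℂ) :=
  (continuous_subtype_val.comp AddCircle.continuous_toCircle).measurable

instance : IsProbabilityMeasure uniformUnitCircle :=
  Measure.isProbabilityMeasure_map measurable_toCircle.aemeasurable

theorem ae_norm_eq_one : ∀ᵐ z ∂uniformUnitCircle, ‖z‖ = 1 := by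
  rw [uniformUnitCircle, ae_map_iff measurable_toCircle.aemeasurable
    (measurableSet_eq_fun measurable_norm measurable_const)]
  exact ae_of_all _ fun θ => Circle.norm_coe _

theorem integrable_uniformUnitCircle {f : ℂ → ℂ} (hf : Continuous f) :
    Integrable f uniformUnitCircle := by
  obtain ⟨B, hB⟩ := (isCompact_sphere (0 : ℂ) 1).exists_bound_of_continuousOn hf.continuousOn
  exact Integrable.of_bound hf.aestronglyMeasurable B
    (ae_norm_eq_one.mono fun z hz => hB z (by simpa using hz))

/-- The Fourier coefficients of a polynomial on the unit circle are its coefficients. -/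
theorem integral_conj_pow_mul_eval (p : ℂ[X]) (m : ℕ) :
    ∫ z, (starRingEnd ℂ) z ^ m * p.eval z ∂uniformUnitCircle = p.coeff m := by
  induction p using Polynomial.induction_on' with
  | add p q hp hq =>
    have hc (r : ℂ[X]) : Continuous fun z => (starRingEnd ℂ) z ^ m * r.eval z :=
      (Complex.continuous_conj.pow m).mul r.continuous
    simp only [eval_add, mul_add, coeff_add]
    rw [integral_add (integrable_uniformUnitCircle (hc p)) (integrable_uniformUnitCircle (hc q)),
      hp, hq]
  | monomial n a =>
    have hc : Continuous fun z => (starRingEnd ℂ) z ^ m * (monomial n a).eval z :=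
      (Complex.continuous_conj.pow m).mul (monomial n a).continuous
    rw [uniformUnitCircle, integral_map measurable_toCircle.aemeasurable hc.aestronglyMeasurable]
    have hf (θ : AddCircle (1 : ℝ)) (j : ℕ) : (AddCircle.toCircle θ : ℂ) ^ j = fourier (j : ℤ) θ := by
      rw [fourier_apply, natCast_zsmul, AddCircle.toCircle_nsmul, Circle.coe_pow]
    have h := congrFun (fourierCoeff_fourier (T := 1) (n : ℤ)) (m : ℤ)
    rw [fourierCoeff] at h
    simp only [eval_monomial, ← map_pow, hf, ← fourier_neg, mul_left_comm _ a]
    rw [integral_const_mul]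
    simp only [smul_eq_mul] at h
    rw [h, coeff_monomial, Pi.single_apply]
    simp [eq_comm]

/-- The mean of the Legendre polynomial at `|P_k|² / 2 ^ (k + 1)` is a normalised Fourier coefficient
of the orbit, which decays by the spectral gap of the transfer operator. -/
theorem tendsto_integral_legendre {n : ℕ} (hn : n ≠ 0) :
    Tendsto (fun k => ∫ z, (legendre n).eval (normalizedSq k z) ∂uniformUnitCircle) atTop (𝓝 0) := by
  have h := (tendsto_orbitCoeff hn).const_mul ((1 / 2 : ℂ) ^ n)
  rw [mul_zero] at h
  have key (k : ℕ) : ((1 / 2 : ℂ) ^ n) * (((1 / 2 : ℂ) ^ n) ^ k * orbitCoeff n k n n) =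
      ((∫ z, (legendre n).eval (normalizedSq k z) ∂uniformUnitCircle : ℝ) : ℂ) := by
    rw [orbitCoeff, ← integral_conj_pow_mul_eval, integral_congr_ae
      (ae_norm_eq_one.mono fun z hz => conj_pow_mul_eval_coeff_orbitForm n k hz),
      integral_const_mul, integral_complex_ofReal, ← mul_assoc, ← mul_assoc, ← pow_succ', ← pow_mul,
      mul_comm n, ← mul_pow]
    norm_num
  simp only [key] at h
  simpa [Function.comp_def] using (Complex.continuous_re.tendsto 0).comp h

theorem law_normalizedSq {Ω : Type*} [MeasurableSpace Ω] {μ : Measure Ω} {ω : Ω → ℂ}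
    (hω : HasLaw ω uniformUnitCircle μ) (k : ℕ) :
    HasLaw (fun x => normalizedSq k (ω x)) (uniformUnitCircle.map (normalizedSq k)) μ :=
  HasLaw.fun_comp (Y := normalizedSq k) ⟨(continuous_normalizedSq k).aemeasurable, rfl⟩ hω

end RudinShapiro

open RudinShapiro in
theorem theorem1 {Ω : Type*} [MeasurableSpace Ω] (μ : Measure Ω) [IsProbabilityMeasure μ]
    (ω : Ω → ℂ) (hω : HasLaw ω uniformUnitCircle μ) :
    (∀ n : ℕ,
      Tendsto
        (fun k : ℕ =>
          ∫ x, ‖(rudinShapiroP k).eval (ω x) / (Real.sqrt (2 ^ (k + 1)) : ℂ)‖ ^ (2 * n) ∂μ)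
        atTop (𝓝 (1 / ((n : ℝ) + 1)))) ∧
    (∀ α β : ℝ, 0 ≤ α → α < β → β ≤ 1 →
      Tendsto
        (fun k : ℕ =>
          μ.real {x | ‖(rudinShapiroP k).eval (ω x) / (Real.sqrt (2 ^ (k + 1)) : ℂ)‖ ^ 2
            ∈ Set.Icc α β})
        atTop (𝓝 (β - α))) := by
  let ν : ℕ → Measure ℝ := fun k => uniformUnitCircle.map (normalizedSq k)
  have hprob (k : ℕ) : IsProbabilityMeasure (ν k) :=
    Measure.isProbabilityMeasure_map (continuous_normalizedSq k).aemeasurable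
  have hν (k : ℕ) : ∀ᵐ x ∂ν k, x ∈ Set.Icc (0 : ℝ) 1 := by
    refine (ae_map_iff (continuous_normalizedSq k).aemeasurable measurableSet_Icc).2 ?_
    exact ae_norm_eq_one.mono fun z hz => normalizedSq_mem_Icc k hz
  have hmom := tendsto_moment hν fun n hn => by
    refine (tendsto_integral_legendre hn).congr fun k => ?_
    rw [integral_map (continuous_normalizedSq k).aemeasurable
      (legendre n).continuous.aestronglyMeasurable]
  constructor
  · intro n
    refine (hmom n).congr fun k => ?_
    simp only [pow_mul]
    exact ((law_normalizedSq hω k).integral_comp (f := fun y => y ^ n)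
      (continuous_pow n).aestronglyMeasurable).symm
  · intro α β hα hαβ hβ
    refine (tendsto_measureReal_Icc hν hmom hα hαβ.le hβ).congr fun k => ?_
    exact ((law_normalizedSq hω k).measureReal_eq
      (p := fun y => y ∈ Set.Icc α β) measurableSet_Icc).symm
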